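/- Let $(\omega_s)_{0\le s\le 1}$ be a standard Brownian bridge from $0$ to $0$ (a centred Gaussian process with continuous paths and covariance $\min(s,t)-st$), with law $\mathbb P_0^0$ and expectation $\mathbb E_0^0$. For $\theta\in\mathbb R$ and $\varepsilon\in[0,1]$ let $$V_\varepsilon^\theta(\omega)=\operatorname{Var}_{[0,1]}\Big[\,t\mapsto \sin\theta\int_t^1\cos(\sqrt\varepsilon\,\omega_s)\,ds+\cos\theta\int_t^1\frac{\sin(\sqrt\varepsilon\,\omega_s)}{\sqrt\varepsilon}\,ds\Big],$$ the variance being taken with respect to Lebesgue measure in $t\in[0,1]$, and $\frac{\sin(\sqrt\varepsilon\,a)}{\sqrt\varepsilon}$ being read as $a$ for $\varepsilon=0$. For real $p\ge 2$ let $$S_p(\omega)=\sup_{0\le t<u\le 1}\frac{|\omega_t-\omega_u|}{|t-u|^{\frac12-\frac1{2p}-\frac1{2p^2}}}.$$ Then for every real $p\ge 2$ one has $S_p\in L^{2p}(\mathbb P_0^0)$, and there is a constant $C_p\in(0,\infty)$, depending only on $p$, such that for every $x\in[0,1]$ $$\sup_{\theta\in\mathbb R}\mathbb P_0^0\Big(\inf_{0\le\varepsilon\le1}V_\varepsilon^\theta<x\Big)\le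 C_p\,\mathbb E_0^0\big(S_p^{2p}\big)\,x^{(2p-3-3/p)/4}+\min\Big\{2,\ \frac{4\sqrt\pi\,x^{-1/8}\,e^{-\frac{\pi}{196}x^{-1/4}}}{7\big(1-e^{-\frac{2\pi}{49}x^{-1/4}}\big)}\Big\},$$ where for $x=0$ both terms on the right-hand side are to be read as limits $x\to0^+$ (the left-hand side being $0$). -/

import Mathlib

open MeasureTheory ProbabilityTheory
open scoped ENNReal

/-- The process `(X t)`, `t ∈ [0, 1]`, is a standard Brownian bridge from `0` to `0` under `P`:
a centred Gaussian process with covariance `min s t - s t` and continuous paths. The process is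
indexed by `ℝ` for convenience; its values outside `[0, 1]` play no role. -/
structure IsBrownianBridge {Ω : Type*} [MeasurableSpace Ω] (P : Measure Ω)
    (X : ℝ → Ω → ℝ) : Prop where
  gaussian : IsGaussianProcess (fun t : Set.Icc (0 : ℝ) 1 => X t) P
  mean : ∀ t ∈ Set.Icc (0 : ℝ) 1, ∫ ω, X t ω ∂P = 0
  cov : ∀ s ∈ Set.Icc (0 : ℝ) 1, ∀ t ∈ Set.Icc (0 : ℝ) 1, cov[X s, X t; P] = min s t - s * t
  continuous_paths : ∀ ω, ContinuousOn (fun t => X t ω) (Set.Icc 0 1)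

/-- `S_p(γ) = sup_{0 ≤ t < u ≤ 1} |γ t - γ u| / |t - u| ^ (1/2 - 1/(2p) - 1/(2p²))`, with value in
`[0, ∞]`. -/
noncomputable def holderSup (p : ℝ) (γ : ℝ → ℝ) : ℝ≥0∞ :=
  ⨆ (t : ℝ) (u : ℝ) (_ : 0 ≤ t ∧ t < u ∧ u ≤ 1),
    ENNReal.ofReal (|γ t - γ u| / |t - u| ^ (1 / 2 - 1 / (2 * p) - 1 / (2 * p ^ 2)))

/-- `sin (√ε a) / √ε`, extended by continuity to `ε = 0`, where it is `a`. -/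
noncomputable def scaledSin (ε a : ℝ) : ℝ :=
  if ε = 0 then a else Real.sin (√ε * a) / √ε

/-- `V_ε^θ(γ)`: the variance, with respect to Lebesgue measure in the variable `t ∈ [0, 1]`, of
`sin θ ∫_t^1 cos (√ε γ_s) ds + cos θ ∫_t^1 sin (√ε γ_s) / √ε ds`. -/
noncomputable def pathVar (θ ε : ℝ) (γ : ℝ → ℝ) : ℝ :=
  Var[fun t : ℝ => Real.sin θ * (∫ s in t..1, Real.cos (√ε * γ s))
      + Real.cos θ * (∫ s in t..1, scaledSin ε (γ s)); volume.restrict (Set.Icc (0 : ℝ) 1)]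

/-! The first term on the right already suffices. The probability decays faster than every power of
`x`, uniformly in `θ` (`exists_measure_iInf_pathVar_lt_le`), and the moment of `holderSup` is
bounded below by a positive number depending only on `p` (`le_lintegral_holderSup_rpow`), so it can
be inserted at the cost of a constant. The minimum is simply discarded.

The decay rests on a deterministic fact, `abs_lt_of_pathVar_lt`. The function whose variance is
taken is a primitive of `-g`, with `g = sin θ cos(√ε γ) + cos θ sin(√ε γ)/√ε`. If `γ` is Hölder and
`|g|` reaches `m`, then `g` keeps its sign and size at least `m/2` on a whole interval, which forces
a variance polynomial in `m`. Hence a tiny variance makes `g` uniformly small. Since `γ 0 = 0`, `g 0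
= sin θ` is small, so `cos θ` is not, and `γ` itself must be uniformly small.

The event therefore lies, up to a null set, in the union of two rare events: a large Hölder
constant, controlled by Markov's inequality with moments of arbitrary order
(`measure_lt_holderSup_le`), and a path confined to a small ball, controlled by arbitrarily many
independent second differences (`measure_abs_le_le`). -/

/-! ### Deterministic part: small variance forces a small path. -/

theorem le_variance_of_mul_abs_sub_le {F : ℝ → ℝ} (hF : ContinuousOn F (Set.Icc 0 1))
    {a b k : ℝ} (ha : 0 ≤ a) (hab : a ≤ b) (hb : b ≤ 1) (hk : 0 ≤ k)
    (h : ∀ s ∈ Set.Icc a b, ∀ t ∈ Set.Icc a b, k * |t - s| ≤ |F t - F s|) :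
    k ^ 2 * (b - a) ^ 3 / 16 ≤ Var[F; volume.restrict (Set.Icc (0 : ℝ) 1)] := by
  have hFm : AEMeasurable F (volume.restrict (Set.Icc (0 : ℝ) 1)) :=
    hF.aemeasurable measurableSet_Icc
  rw [variance_eq_integral hFm]
  set c := ∫ x, F x ∂(volume.restrict (Set.Icc (0 : ℝ) 1))
  set G : ℝ → ℝ := fun t => (F t - c) ^ 2 with hG
  have hGc : ContinuousOn G (Set.Icc 0 1) := by fun_prop
  set d := (b - a) / 2 with hd
  have hd0 : 0 ≤ d := by simp only [hd]; linarith
  have hsub : Set.Icc a b ⊆ Set.Icc 0 1 := Set.Icc_subset_Icc ha hb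
  have hm : a + d ∈ Set.Icc a b := ⟨by linarith, by simp only [hd]; linarith⟩
  have hb' : b = a + d + d := by simp only [hd]; ring
  have i1 : IntervalIntegrable G volume a (a + d) :=
    (hGc.mono ((Set.Icc_subset_Icc_right hm.2).trans hsub)).intervalIntegrable_of_Icc hm.1
  have i2 : IntervalIntegrable G volume (a + d) b :=
    (hGc.mono ((Set.Icc_subset_Icc_left hm.1).trans hsub)).intervalIntegrable_of_Icc hm.2
  have i3 : IntervalIntegrable (fun t => G (t + d)) volume a (a + d) := by
    have := i2.comp_add_right d
    rwa [hb', add_sub_cancel_right, add_sub_cancel_right] at this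
  have e1 : ∫ t in Set.Icc a b, G t = ∫ t in a..(a + d), (G t + G (t + d)) := by
    rw [integral_Icc_eq_integral_Ioc, ← intervalIntegral.integral_of_le hab,
      ← intervalIntegral.integral_add_adjacent_intervals i1 i2,
      intervalIntegral.integral_add i1 i3, intervalIntegral.integral_comp_add_right, ← hb']
  have e2 : ∫ t in Set.Icc a b, G t ≤ ∫ t in Set.Icc (0 : ℝ) 1, G t :=
    setIntegral_mono_set (hGc.integrableOn_Icc) (ae_of_all _ fun t => sq_nonneg _)
      (LE.le.eventuallyLE hsub)
  refine le_trans ?_ e2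
  rw [e1]
  -- Each `t` in the left half is paired with `t + d` in the right half: `(u - c)² + (v - c)² ≥ (u -
  -- v)²/2` for any centre `c`, so the mean never has to be computed.
  have e3 : ∫ _ in a..(a + d), (k * d) ^ 2 / 2 ≤ ∫ t in a..(a + d), (G t + G (t + d)) := by
    refine intervalIntegral.integral_mono_on hm.1 intervalIntegrable_const (i1.add i3) ?_
    intro t ht
    have h1 := h t ⟨ht.1, ht.2.trans hm.2⟩ (t + d) ⟨by linarith [ht.1], by linarith [ht.2]⟩
    rw [add_sub_cancel_left, abs_of_nonneg hd0] at h1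
    have h2 : (k * d) ^ 2 ≤ (F (t + d) - F t) ^ 2 := by
      rw [← sq_abs (F (t + d) - F t)]
      gcongr
    simp only [hG]
    nlinarith [sq_nonneg (F (t + d) - c + (F t - c))]
  refine le_trans (le_of_eq ?_) e3
  rw [intervalIntegral.integral_const, smul_eq_mul, hd]
  ring

theorem mul_abs_sub_le_abs_integral {g : ℝ → ℝ} {a b k : ℝ}
    (hg : ContinuousOn g (Set.Icc a b))
    (h : (∀ t ∈ Set.Icc a b, k ≤ g t) ∨ ∀ t ∈ Set.Icc a b, g t ≤ -k)
    {s t : ℝ} (hs : s ∈ Set.Icc a b) (ht : t ∈ Set.Icc a b) :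
    k * |t - s| ≤ |∫ r in s..t, g r| := by
  wlog hst : s ≤ t generalizing s t
  · rw [intervalIntegral.integral_symm, abs_neg, abs_sub_comm]
    exact this ht hs (le_of_not_ge hst)
  have hsub : Set.Icc s t ⊆ Set.Icc a b := Set.Icc_subset_Icc hs.1 ht.2
  have hi : IntervalIntegrable g volume s t := (hg.mono hsub).intervalIntegrable_of_Icc hst
  rw [abs_of_nonneg (sub_nonneg.2 hst)]
  rcases h with h | h
  · refine le_trans ?_ (le_abs_self _)
    have := intervalIntegral.integral_mono_on hst intervalIntegrable_const hi
      (fun r hr => h r (hsub hr))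
    rw [intervalIntegral.integral_const, smul_eq_mul] at this
    linarith
  · refine le_trans ?_ (neg_le_abs _)
    have := intervalIntegral.integral_mono_on hst hi intervalIntegrable_const
      (fun r hr => h r (hsub hr))
    rw [intervalIntegral.integral_const, smul_eq_mul] at this
    linarith

theorem abs_lt_of_variance_integral_lt {g : ℝ → ℝ} {m H : ℝ} (hg : ContinuousOn g (Set.Icc 0 1))
    (hH : 1 ≤ H) (hm0 : 0 < m) (hm1 : m ≤ 1)
    (hgH : ∀ t ∈ Set.Icc (0 : ℝ) 1, ∀ u ∈ Set.Icc (0 : ℝ) 1,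
      |g t - g u| ≤ 2 * H * |t - u| ^ (1 / 8 : ℝ))
    (hV : Var[fun t => ∫ s in t..1, g s; volume.restrict (Set.Icc (0 : ℝ) 1)]
      < m ^ 26 / (4 ^ 27 * H ^ 24)) :
    ∀ t ∈ Set.Icc (0 : ℝ) 1, |g t| < m := by
  intro t₀ ht₀
  by_contra! hcon
  refine absurd hV (not_lt.2 ?_)
  -- Chosen so that over a distance `r ^ 8` the modulus `2 * H * r` equals `m / 2`. The variance
  -- bound `(m/2)² (r ^ 8)³ / 16` is then exactly the one in the hypothesis.
  set r := m / (4 * H) with hr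
  have hr0 : 0 < r := by positivity
  have hr1 : r ≤ 1 / 4 := by
    rw [hr, div_le_div_iff₀ (by positivity) (by norm_num)]
    linarith
  have hl1 : r ^ 8 ≤ 1 / 2 := by
    calc r ^ 8 ≤ (1 / 4 : ℝ) ^ 8 := by gcongr
      _ ≤ 1 / 2 := by norm_num
  have hl0 : 0 < r ^ 8 := by positivity
  -- The interval extends to the right or to the left of `t₀`, whichever stays in `[0, 1]`.
  obtain ⟨a, ha0, ha1, hat, hta⟩ : ∃ a : ℝ, 0 ≤ a ∧ a + r ^ 8 ≤ 1 ∧ a ≤ t₀ ∧ t₀ ≤ a + r ^ 8 := by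
    rcases le_total t₀ (1 / 2) with h | h
    · exact ⟨t₀, ht₀.1, by linarith, le_rfl, by linarith⟩
    · exact ⟨t₀ - r ^ 8, by linarith, by linarith [ht₀.2], by linarith, by linarith⟩
  have hsub : Set.Icc a (a + r ^ 8) ⊆ Set.Icc 0 1 := Set.Icc_subset_Icc ha0 ha1
  have hclose : ∀ s ∈ Set.Icc a (a + r ^ 8), |g s - g t₀| ≤ m / 2 := by
    intro s hs
    refine (hgH s (hsub hs) t₀ ht₀).trans ?_
    have h1 : |s - t₀| ≤ r ^ 8 := abs_le.2 ⟨by linarith [hs.1], by linarith [hs.2]⟩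
    have h2 : |s - t₀| ^ (1 / 8 : ℝ) ≤ r := by
      calc |s - t₀| ^ (1 / 8 : ℝ) ≤ (r ^ 8) ^ (1 / 8 : ℝ) := by gcongr
        _ = r := by
          rw [← Real.rpow_natCast, ← Real.rpow_mul hr0.le]; norm_num
    calc 2 * H * |s - t₀| ^ (1 / 8 : ℝ) ≤ 2 * H * r := by gcongr
      _ = m / 2 := by rw [hr]; field_simp; norm_num
  have hsign : (∀ t ∈ Set.Icc a (a + r ^ 8), m / 2 ≤ g t)
      ∨ ∀ t ∈ Set.Icc a (a + r ^ 8), g t ≤ -(m / 2) := by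
    rcases le_abs.1 hcon with h | h
    · left; intro t ht; linarith [(abs_le.1 (hclose t ht)).1]
    · right; intro t ht; linarith [(abs_le.1 (hclose t ht)).2]
  have hint : ∀ t ∈ Set.Icc (0 : ℝ) 1, ∀ s ∈ Set.Icc (0 : ℝ) 1,
      IntervalIntegrable g volume t s := fun t ht s hs =>
    (hg.mono (Set.uIcc_subset_Icc ht hs)).intervalIntegrable
  have h1m : (1 : ℝ) ∈ Set.Icc (0 : ℝ) 1 := by simp
  have hFc : ContinuousOn (fun t => ∫ s in t..1, g s) (Set.Icc 0 1) := by
    have := intervalIntegral.continuousOn_primitive_interval_left (μ := volume) (f := g)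
      (a := 0) (b := 1) (by rw [Set.uIcc_of_le zero_le_one]; exact hg.integrableOn_Icc)
    rwa [Set.uIcc_of_le zero_le_one] at this
  have := le_variance_of_mul_abs_sub_le hFc (k := m / 2) ha0 (by linarith) ha1 (by positivity)
    (by
      intro s hs t ht
      have e : (∫ x in t..1, g x) - ∫ x in s..1, g x = ∫ x in t..s, g x := by
        rw [← intervalIntegral.integral_add_adjacent_intervals (hint t (hsub ht) s (hsub hs))
          (hint s (hsub hs) 1 h1m)]
        ring
      rw [e, abs_sub_comm]
      exact mul_abs_sub_le_abs_integral (hg.mono hsub) hsign ht hs)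
  refine le_trans (le_of_eq ?_) this
  rw [hr]
  field_simp
  ring

theorem abs_scaledSin_sub_le {ε : ℝ} (hε : 0 ≤ ε) (a b : ℝ) :
    |scaledSin ε a - scaledSin ε b| ≤ |a - b| := by
  unfold scaledSin
  split_ifs with h
  · exact le_rfl
  · have hs : 0 < √ε := Real.sqrt_pos.2 (lt_of_le_of_ne hε (Ne.symm h))
    rw [← sub_div, abs_div, abs_of_pos hs, div_le_iff₀ hs]
    calc |Real.sin (√ε * a) - Real.sin (√ε * b)| ≤ |√ε * a - √ε * b| := by
          simpa [Real.dist_eq] using Real.lipschitzWith_sin.dist_le_mul (√ε * a) (√ε * b)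
      _ = |a - b| * √ε := by rw [← mul_sub, abs_mul, abs_of_pos hs, mul_comm]

theorem abs_cos_sqrt_mul_sub_le {ε : ℝ} (hε : ε ≤ 1) (a b : ℝ) :
    |Real.cos (√ε * a) - Real.cos (√ε * b)| ≤ |a - b| := by
  have hs : √ε ≤ 1 := Real.sqrt_le_one.2 hε
  calc |Real.cos (√ε * a) - Real.cos (√ε * b)| ≤ |√ε * a - √ε * b| := by
        simpa [Real.dist_eq] using Real.lipschitzWith_cos.dist_le_mul (√ε * a) (√ε * b)
    _ = √ε * |a - b| := by rw [← mul_sub, abs_mul, abs_of_nonneg (Real.sqrt_nonneg _)]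
    _ ≤ |a - b| := mul_le_of_le_one_left (abs_nonneg _) hs

theorem scaledSin_zero_right (ε : ℝ) : scaledSin ε 0 = 0 := by
  simp [scaledSin]

theorem half_mul_abs_le_abs_scaledSin {ε a : ℝ} (hε : ε ∈ Set.Icc (0 : ℝ) 1) (ha : |a| ≤ 1) :
    |a| / 2 ≤ |scaledSin ε a| := by
  unfold scaledSin
  split_ifs with h
  · linarith [abs_nonneg a]
  · have hs : 0 < √ε := Real.sqrt_pos.2 (lt_of_le_of_ne hε.1 (Ne.symm h))
    have hs1 : √ε ≤ 1 := Real.sqrt_le_one.2 hε.2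
    rw [abs_div, abs_of_pos hs, le_div_iff₀ hs]
    have h1 : |√ε * a| ≤ 1 := by
      rw [abs_mul, abs_of_pos hs]; exact mul_le_one₀ hs1 (abs_nonneg _) ha
    have h2 := Real.mul_abs_le_abs_sin (x := √ε * a) (by linarith [Real.pi_gt_three])
    rw [abs_mul √ε a, abs_of_pos hs] at h2
    have h3 : 1 / 2 ≤ 2 / Real.pi := by
      rw [div_le_div_iff₀ (by norm_num) Real.pi_pos]; linarith [Real.pi_le_four]
    have h4 : 1 / 2 * (√ε * |a|) ≤ 2 / Real.pi * (√ε * |a|) := by gcongr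
    linarith

theorem abs_lt_of_pathVar_lt {γ : ℝ → ℝ} {θ ε m H : ℝ} (hγ : ContinuousOn γ (Set.Icc 0 1))
    (hγ0 : γ 0 = 0) (hH : 1 ≤ H) (hm0 : 0 < m) (hm1 : m ≤ 1 / 8)
    (hγH : ∀ t ∈ Set.Icc (0 : ℝ) 1, ∀ u ∈ Set.Icc (0 : ℝ) 1,
      |γ t - γ u| ≤ H * |t - u| ^ (1 / 8 : ℝ))
    (hε : ε ∈ Set.Icc (0 : ℝ) 1) (hV : pathVar θ ε γ < m ^ 26 / (4 ^ 27 * H ^ 24)) :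
    ∀ t ∈ Set.Icc (0 : ℝ) 1, |γ t| < 8 * m := by
  have hcs : Continuous (scaledSin ε) :=
    (LipschitzWith.of_dist_le_mul (K := 1) fun a b => by
      simpa [Real.dist_eq] using abs_scaledSin_sub_le hε.1 a b).continuous
  have hc1 : ContinuousOn (fun s => Real.cos (√ε * γ s)) (Set.Icc 0 1) := by fun_prop
  have hc2 : ContinuousOn (fun s => scaledSin ε (γ s)) (Set.Icc 0 1) := hcs.comp_continuousOn hγ
  set g : ℝ → ℝ := fun s => Real.sin θ * Real.cos (√ε * γ s) + Real.cos θ * scaledSin ε (γ s)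
    with hgdef
  have hgc : ContinuousOn g (Set.Icc 0 1) := by fun_prop
  have hgH : ∀ t ∈ Set.Icc (0 : ℝ) 1, ∀ u ∈ Set.Icc (0 : ℝ) 1,
      |g t - g u| ≤ 2 * H * |t - u| ^ (1 / 8 : ℝ) := by
    intro t ht u hu
    have h1 := abs_cos_sqrt_mul_sub_le hε.2 (γ t) (γ u)
    have h2 := abs_scaledSin_sub_le hε.1 (γ t) (γ u)
    have h3 := hγH t ht u hu
    have e : g t - g u = Real.sin θ * (Real.cos (√ε * γ t) - Real.cos (√ε * γ u))
        + Real.cos θ * (scaledSin ε (γ t) - scaledSin ε (γ u)) := by simp only [hgdef]; ring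
    rw [e]
    refine (abs_add_le _ _).trans ?_
    rw [abs_mul, abs_mul]
    have h4 := mul_le_of_le_one_left (abs_nonneg (Real.cos (√ε * γ t) - Real.cos (√ε * γ u)))
      (Real.abs_sin_le_one θ)
    have h5 := mul_le_of_le_one_left (abs_nonneg (scaledSin ε (γ t) - scaledSin ε (γ u)))
      (Real.abs_cos_le_one θ)
    linarith
  have hvar : pathVar θ ε γ
      = Var[fun t => ∫ s in t..1, g s; volume.restrict (Set.Icc (0 : ℝ) 1)] := by
    refine variance_congr ?_
    filter_upwards [ae_restrict_mem measurableSet_Icc] with t ht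
    have hsub : Set.Icc t 1 ⊆ Set.Icc 0 1 := Set.Icc_subset_Icc_left ht.1
    rw [intervalIntegral.integral_add
      (((hc1.mono hsub).intervalIntegrable_of_Icc ht.2).const_mul _)
      (((hc2.mono hsub).intervalIntegrable_of_Icc ht.2).const_mul _),
      intervalIntegral.integral_const_mul, intervalIntegral.integral_const_mul]
  rw [hvar] at hV
  have hsmall := abs_lt_of_variance_integral_lt hgc hH hm0 (by linarith) hgH hV
  -- At time `0` the path vanishes, so `g 0 = sin θ`.
  have hsin : |Real.sin θ| < m := by
    have := hsmall 0 (by simp)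
    simpa [hgdef, hγ0, scaledSin_zero_right] using this
  have hcos : 1 / 2 ≤ |Real.cos θ| := by
    have h1 := Real.sin_sq_add_cos_sq θ
    have h2 : Real.sin θ ^ 2 ≤ (1 / 8) ^ 2 := by
      rw [← sq_abs]; gcongr; linarith
    refine abs_le_of_sq_le_sq' (a := 1 / 2) ?_ (abs_nonneg _) |>.2
    rw [sq_abs]; linarith
  have hss : ∀ t ∈ Set.Icc (0 : ℝ) 1, |scaledSin ε (γ t)| < 4 * m := by
    intro t ht
    have h1 := hsmall t ht
    have h2 : |Real.cos θ| * |scaledSin ε (γ t)| < 2 * m := by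
      rw [← abs_mul]
      have e : Real.cos θ * scaledSin ε (γ t) = g t - Real.sin θ * Real.cos (√ε * γ t) := by
        simp only [hgdef]; ring
      rw [e]
      refine (abs_sub _ _).trans_lt ?_
      rw [abs_mul]
      have := mul_le_of_le_one_right (abs_nonneg (Real.sin θ)) (Real.abs_cos_le_one (√ε * γ t))
      linarith
    nlinarith [abs_nonneg (scaledSin ε (γ t))]
  intro t ht
  by_contra! hcon
  -- `scaledSin` also vanishes far from `0`, so its smallness alone does not bound `γ`. By
  -- continuity a path leaving the ball would first take the modulus `8 * m ≤ 1`, where `scaledSin`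
  -- is at least `4 * m`.
  have hpc : ContinuousOn (fun s => |γ s|) (Set.Icc 0 t) :=
    (hγ.mono (Set.Icc_subset_Icc_right ht.2)).abs
  obtain ⟨s, hs, hse⟩ := intermediate_value_Icc ht.1 hpc
    (show 8 * m ∈ Set.Icc |γ 0| |γ t| from ⟨by rw [hγ0]; simp; linarith, hcon⟩)
  simp only at hse
  have h1 := hss s ⟨hs.1, hs.2.trans ht.2⟩
  have h2 := half_mul_abs_le_abs_scaledSin hε (a := γ s) (by rw [hse]; linarith)
  rw [hse] at h2
  linarith

/-! ### Dyadic chaining: from dyadic increments to a Hölder bound. -/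

section Chaining

variable {γ : ℝ → ℝ} {b ρ : ℝ}

/-- Refining the dyadic floor of `t` by one level either leaves the point fixed or moves it by one
step of the finer grid. -/
theorem abs_sub_dyadic_succ_le
    (h : ∀ n k : ℕ, k < 2 ^ n → |γ ((k + 1 : ℕ) / 2 ^ n) - γ (k / 2 ^ n)| ≤ b * ρ ^ n)
    (hb : 0 ≤ b) (hρ : 0 ≤ ρ) {t : ℝ} (ht : t ∈ Set.Icc (0 : ℝ) 1) (n : ℕ) :
    |γ (⌊2 ^ (n + 1) * t⌋₊ / 2 ^ (n + 1)) - γ (⌊2 ^ n * t⌋₊ / 2 ^ n)| ≤ b * ρ ^ (n + 1) := by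
  set k := ⌊2 ^ n * t⌋₊ with hk
  set k' := ⌊2 ^ (n + 1) * t⌋₊ with hk'
  have ht0 := ht.1
  have e : (k : ℝ) / 2 ^ n = (2 * k : ℕ) / 2 ^ (n + 1) := by
    push_cast; field_simp; ring
  have h1 : (k : ℝ) ≤ 2 ^ n * t := Nat.floor_le (by positivity)
  have h2 : 2 ^ n * t < k + 1 := Nat.lt_floor_add_one _
  have h3 : 2 * k ≤ k' := by
    refine Nat.le_floor ?_
    push_cast
    rw [pow_succ]; linarith
  have h4 : k' < 2 * k + 2 := by
    refine (Nat.floor_lt (by positivity)).2 ?_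
    push_cast
    rw [pow_succ]; linarith
  have h5 : k' ≤ 2 ^ (n + 1) := by
    refine Nat.floor_le_of_le ?_
    push_cast
    exact mul_le_of_le_one_right (by positivity) ht.2
  rw [e]
  rcases (by omega : k' = 2 * k ∨ k' = 2 * k + 1) with h6 | h6
  · rw [h6, sub_self, abs_zero]; positivity
  · rw [h6]; exact h (n + 1) (2 * k) (by omega)

theorem abs_sub_dyadic_le (hγ : ContinuousOn γ (Set.Icc 0 1))
    (h : ∀ n k : ℕ, k < 2 ^ n → |γ ((k + 1 : ℕ) / 2 ^ n) - γ (k / 2 ^ n)| ≤ b * ρ ^ n)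
    (hb : 0 ≤ b) (hρ : 0 ≤ ρ) (hρ1 : ρ < 1) {t : ℝ} (ht : t ∈ Set.Icc (0 : ℝ) 1) (n : ℕ) :
    |γ t - γ (⌊2 ^ n * t⌋₊ / 2 ^ n)| ≤ b * ρ ^ n / (1 - ρ) := by
  set τ : ℕ → ℝ := fun j => ⌊2 ^ j * t⌋₊ / 2 ^ j with hτ
  have h1ρ : 0 < 1 - ρ := sub_pos.2 hρ1
  have hstep : ∀ j, |γ (τ (n + j)) - γ (τ n)| ≤ b * ρ ^ n / (1 - ρ) * (1 - ρ ^ j) := by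
    intro j
    induction j with
    | zero => simp
    | succ j ih =>
      have h1 := abs_sub_dyadic_succ_le h hb hρ ht (n + j)
      have h2 := abs_sub_le (γ (τ (n + (j + 1)))) (γ (τ (n + j))) (γ (τ n))
      have h3 : b * ρ ^ n / (1 - ρ) * (1 - ρ ^ (j + 1))
          = b * ρ ^ (n + j) + b * ρ ^ n / (1 - ρ) * (1 - ρ ^ j) := by
        field_simp; ring
      -- One factor `ρ` is given up to match the closed form of the geometric sum.
      have h4 : b * ρ ^ (n + j + 1) ≤ b * ρ ^ (n + j) := by
        refine mul_le_mul_of_nonneg_left ?_ hb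
        exact pow_le_pow_of_le_one hρ hρ1.le (Nat.le_succ _)
      rw [h3]
      refine h2.trans (add_le_add (h1.trans h4) ih)
  have hτm : ∀ j, τ j ∈ Set.Icc (0 : ℝ) 1 := by
    intro j
    refine ⟨by positivity, ?_⟩
    simp only [hτ]
    rw [div_le_one (by positivity)]
    exact (Nat.floor_le (mul_nonneg (by positivity) ht.1)).trans
      (mul_le_of_le_one_right (by positivity) ht.2)
  have hlim : Filter.Tendsto τ Filter.atTop (nhds t) := by
    have h1 : Filter.Tendsto (fun j : ℕ => (2 : ℝ) ^ j) Filter.atTop Filter.atTop :=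
      tendsto_pow_atTop_atTop_of_one_lt (by norm_num)
    have := (tendsto_nat_floor_mul_div_atTop ht.1).comp h1
    refine this.congr fun j => ?_
    simp [hτ, mul_comm]
  have hlim2 : Filter.Tendsto (fun j => γ (τ (n + j))) Filter.atTop (nhds (γ t)) := by
    have h1 : Filter.Tendsto (fun j => τ (n + j)) Filter.atTop (nhdsWithin t (Set.Icc 0 1)) :=
      tendsto_nhdsWithin_iff.2 ⟨hlim.comp (Filter.tendsto_add_atTop_nat n |>.congr fun j => by
        rw [add_comm]), Filter.Eventually.of_forall fun j => hτm _⟩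
    exact (hγ t ht).tendsto.comp h1
  refine le_of_tendsto ((hlim2.sub_const _).abs) (Filter.Eventually.of_forall fun j => ?_)
  refine (hstep j).trans (mul_le_of_le_one_right (by positivity) ?_)
  linarith [pow_nonneg hρ j]

/-- At level `n` the dyadic floors of `t` and `u` coincide or are neighbours, so one grid increment
and two chaining tails suffice. -/
theorem abs_sub_le_of_abs_sub_le_pow (hγ : ContinuousOn γ (Set.Icc 0 1))
    (h : ∀ n k : ℕ, k < 2 ^ n → |γ ((k + 1 : ℕ) / 2 ^ n) - γ (k / 2 ^ n)| ≤ b * ρ ^ n)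
    (hb : 0 ≤ b) (hρ : 0 ≤ ρ) (hρ1 : ρ < 1) {t u : ℝ} (ht : 0 ≤ t) (htu : t ≤ u) (hu : u ≤ 1)
    {n : ℕ} (hn : u - t ≤ (1 / 2) ^ n) :
    |γ t - γ u| ≤ (1 + 2 / (1 - ρ)) * b * ρ ^ n := by
  have htm : t ∈ Set.Icc (0 : ℝ) 1 := ⟨ht, htu.trans hu⟩
  have hum : u ∈ Set.Icc (0 : ℝ) 1 := ⟨ht.trans htu, hu⟩
  have h1 := abs_sub_dyadic_le hγ h hb hρ hρ1 htm n
  have h2 := abs_sub_dyadic_le hγ h hb hρ hρ1 hum n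
  have h3 : |γ (⌊2 ^ n * u⌋₊ / 2 ^ n) - γ (⌊2 ^ n * t⌋₊ / 2 ^ n)| ≤ b * ρ ^ n := by
    have hu0 := hum.1
    have hp : (0 : ℝ) < 2 ^ n := by positivity
    have hlt : 2 ^ n * u ≤ 2 ^ n * t + 1 := by
      rw [one_div, inv_pow] at hn
      have := mul_le_mul_of_nonneg_left hn hp.le
      rw [mul_inv_cancel₀ hp.ne'] at this
      linarith
    have a1 : ⌊2 ^ n * t⌋₊ ≤ ⌊2 ^ n * u⌋₊ := Nat.floor_le_floor (by gcongr)
    have a2 : ⌊2 ^ n * u⌋₊ ≤ ⌊2 ^ n * t⌋₊ + 1 := by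
      rw [← Nat.floor_add_one (by positivity)]
      exact Nat.floor_le_floor hlt
    have a3 : ⌊2 ^ n * u⌋₊ ≤ 2 ^ n := by
      refine Nat.floor_le_of_le ?_
      push_cast
      exact mul_le_of_le_one_right hp.le hu
    rcases (by omega : ⌊2 ^ n * u⌋₊ = ⌊2 ^ n * t⌋₊ ∨ ⌊2 ^ n * u⌋₊ = ⌊2 ^ n * t⌋₊ + 1) with e | e
    · rw [e, sub_self, abs_zero]; positivity
    · rw [e]; exact h n _ (by omega)
  have h4 : (1 + 2 / (1 - ρ)) * b * ρ ^ n
      = b * ρ ^ n / (1 - ρ) + b * ρ ^ n + b * ρ ^ n / (1 - ρ) := by ring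
  rw [h4]
  rw [abs_sub_comm] at h2 h3
  have h5 := abs_sub_le (γ t) (γ (⌊2 ^ n * t⌋₊ / 2 ^ n)) (γ u)
  have h6 := abs_sub_le (γ (⌊2 ^ n * t⌋₊ / 2 ^ n)) (γ (⌊2 ^ n * u⌋₊ / 2 ^ n)) (γ u)
  linarith

/-- The Hölder constant lost in passing from dyadic increments to all increments. -/
noncomputable def dyadicConst (α : ℝ) : ℝ := (1 + 2 / (1 - (1 / 2 : ℝ) ^ α)) * 2 ^ α

theorem dyadicConst_pos {α : ℝ} (hα : 0 < α) : 0 < dyadicConst α := by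
  have : (1 / 2 : ℝ) ^ α < 1 := Real.rpow_lt_one (by norm_num) (by norm_num) hα
  have : 0 < 1 - (1 / 2 : ℝ) ^ α := sub_pos.2 this
  unfold dyadicConst
  positivity

theorem abs_sub_le_rpow_of_dyadic {α : ℝ} (hα : 0 < α) (hγ : ContinuousOn γ (Set.Icc 0 1))
    (hb : 0 ≤ b)
    (h : ∀ n k : ℕ, k < 2 ^ n →
      |γ ((k + 1 : ℕ) / 2 ^ n) - γ (k / 2 ^ n)| ≤ b * ((1 / 2 : ℝ) ^ α) ^ n)
    {t u : ℝ} (ht : 0 ≤ t) (htu : t < u) (hu : u ≤ 1) :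
    |γ t - γ u| ≤ dyadicConst α * b * |t - u| ^ α := by
  have hρ1 : (1 / 2 : ℝ) ^ α < 1 := Real.rpow_lt_one (by norm_num) (by norm_num) hα
  have hρ0 : 0 < (1 / 2 : ℝ) ^ α := by positivity
  -- Here `2⁻⁽ⁿ⁺¹⁾ < u - t ≤ 2⁻ⁿ`; the lost factor `2` is the `2 ^ α` in `dyadicConst`.
  obtain ⟨n, hn1, hn2⟩ := exists_nat_pow_near_of_lt_one (sub_pos.2 htu) (by linarith)
    (show (0 : ℝ) < 1 / 2 by norm_num) (by norm_num)
  refine (abs_sub_le_of_abs_sub_le_pow hγ h hb hρ0.le hρ1 ht htu.le hu hn2).trans ?_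
  have h1 : ((1 / 2 : ℝ) ^ α) ^ n ≤ 2 ^ α * |t - u| ^ α := by
    rw [abs_sub_comm, abs_of_pos (sub_pos.2 htu), ← Real.rpow_natCast, ← Real.rpow_mul (by norm_num),
      mul_comm α, Real.rpow_mul (by norm_num), Real.rpow_natCast,
      ← Real.mul_rpow (by norm_num) (sub_pos.2 htu).le]
    refine Real.rpow_le_rpow (by positivity) ?_ hα.le
    rw [pow_succ] at hn1
    linarith
  have h2 : 0 < 1 - (1 / 2 : ℝ) ^ α := sub_pos.2 hρ1
  calc (1 + 2 / (1 - (1 / 2 : ℝ) ^ α)) * b * ((1 / 2 : ℝ) ^ α) ^ n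
      ≤ (1 + 2 / (1 - (1 / 2 : ℝ) ^ α)) * b * (2 ^ α * |t - u| ^ α) := by gcongr
    _ = dyadicConst α * b * |t - u| ^ α := by unfold dyadicConst; ring

end Chaining

/-- Every weighted dyadic increment is at most the whole sum, so the `r`-th root of the sum serves
as a uniform constant in the chaining bound. The sum, unlike a supremum, can be integrated term by
term. -/
theorem rpow_le_of_tsum_dyadic {r α : ℝ} (hr : 0 < r) (hα : 0 < α) {γ : ℝ → ℝ}
    (hγ : ContinuousOn γ (Set.Icc 0 1)) {t u : ℝ} (ht : 0 ≤ t) (htu : t < u) (hu : u ≤ 1) :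
    ENNReal.ofReal (|γ t - γ u| / |t - u| ^ α) ^ r
      ≤ ENNReal.ofReal (dyadicConst α ^ r) * ∑' n : ℕ, ∑ k ∈ Finset.range (2 ^ n),
        ENNReal.ofReal (((2 : ℝ) ^ (α * r)) ^ n)
          * ENNReal.ofReal |γ ((k + 1 : ℕ) / 2 ^ n) - γ (k / 2 ^ n)| ^ r := by
  set B : ℝ≥0∞ := ∑' n : ℕ, ∑ k ∈ Finset.range (2 ^ n),
        ENNReal.ofReal (((2 : ℝ) ^ (α * r)) ^ n)
          * ENNReal.ofReal |γ ((k + 1 : ℕ) / 2 ^ n) - γ (k / 2 ^ n)| ^ r with hB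
  have hKpos : 0 < dyadicConst α := dyadicConst_pos hα
  by_cases hBt : B = ⊤
  · rw [hBt, ENNReal.mul_top]
    · exact le_top
    · exact (ENNReal.ofReal_pos.2 (by positivity)).ne'
  set b := B.toReal ^ (1 / r) with hb
  have hb0 : 0 ≤ b := by positivity
  have hinc : ∀ n k : ℕ, k < 2 ^ n →
      |γ ((k + 1 : ℕ) / 2 ^ n) - γ (k / 2 ^ n)| ≤ b * ((1 / 2 : ℝ) ^ α) ^ n := by
    intro n k hk
    set y := |γ ((k + 1 : ℕ) / 2 ^ n) - γ (k / 2 ^ n)| with hy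
    have hy0 : 0 ≤ y := abs_nonneg _
    have h1 : ENNReal.ofReal (((2 : ℝ) ^ (α * r)) ^ n) * ENNReal.ofReal y ^ r ≤ B := by
      refine le_trans ?_ (ENNReal.le_tsum n)
      exact Finset.single_le_sum (f := fun k : ℕ => ENNReal.ofReal (((2 : ℝ) ^ (α * r)) ^ n)
          * ENNReal.ofReal |γ ((k + 1 : ℕ) / 2 ^ n) - γ (k / 2 ^ n)| ^ r)
        (fun _ _ => zero_le) (Finset.mem_range.2 hk)
    rw [ENNReal.ofReal_rpow_of_nonneg hy0 hr.le, ← ENNReal.ofReal_mul (by positivity),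
      ENNReal.ofReal_le_iff_le_toReal hBt] at h1
    have h2 : (((2 : ℝ) ^ (α * r)) ^ n) * y ^ r = (((2 : ℝ) ^ α) ^ n * y) ^ r := by
      rw [Real.mul_rpow (by positivity) hy0, ← Real.rpow_natCast, ← Real.rpow_natCast,
        ← Real.rpow_mul (by positivity), ← Real.rpow_mul (by positivity),
        ← Real.rpow_mul (by positivity)]
      congr 2
      ring
    rw [h2] at h1
    have h3 : ((2 : ℝ) ^ α) ^ n * y ≤ b := by
      have := Real.rpow_le_rpow (by positivity) h1 (show 0 ≤ 1 / r by positivity)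
      rwa [← Real.rpow_mul (by positivity), mul_one_div_cancel hr.ne', Real.rpow_one] at this
    have h4 : ((1 / 2 : ℝ) ^ α) ^ n = (((2 : ℝ) ^ α) ^ n)⁻¹ := by
      rw [one_div, Real.inv_rpow (by norm_num), inv_pow]
    rw [h4, ← div_eq_mul_inv, le_div_iff₀ (by positivity)]
    linarith
  have h5 := abs_sub_le_rpow_of_dyadic hα hγ hb0 hinc ht htu hu
  have h6 : 0 < |t - u| ^ α := Real.rpow_pos_of_pos (abs_pos.2 (sub_ne_zero.2 htu.ne)) _
  have h7 : |γ t - γ u| / |t - u| ^ α ≤ dyadicConst α * b := by rwa [div_le_iff₀ h6]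
  rw [ENNReal.ofReal_rpow_of_nonneg (by positivity) hr.le]
  have h8 : (|γ t - γ u| / |t - u| ^ α) ^ r ≤ dyadicConst α ^ r * B.toReal := by
    refine (Real.rpow_le_rpow (by positivity) h7 hr.le).trans (le_of_eq ?_)
    rw [Real.mul_rpow hKpos.le hb0, hb, ← Real.rpow_mul (by positivity),
      one_div_mul_cancel hr.ne', Real.rpow_one]
  refine (ENNReal.ofReal_le_ofReal h8).trans (le_of_eq ?_)
  rw [ENNReal.ofReal_mul (by positivity), ENNReal.ofReal_toReal hBt]

/-! ### Moments of Gaussian increments and of the Hölder seminorm. -/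

/-- The absolute moment of order `r` of the standard normal law. -/
noncomputable def stdNormalAbsMoment (r : ℝ) : ℝ≥0∞ :=
  ∫⁻ x, ENNReal.ofReal |x| ^ r ∂(gaussianReal 0 1)

theorem stdNormalAbsMoment_ne_top {r : ℝ} (hr : 0 < r) : stdNormalAbsMoment r ≠ ⊤ := by
  have h := (memLp_id_gaussianReal' (μ := 0) (v := 1) (ENNReal.ofReal r) ENNReal.ofReal_ne_top)
  have := lintegral_rpow_enorm_lt_top_of_eLpNorm_lt_top (ENNReal.ofReal_pos.2 hr).ne'
    ENNReal.ofReal_ne_top h.2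
  rw [ENNReal.toReal_ofReal hr.le] at this
  refine ne_of_lt (lt_of_eq_of_lt ?_ this)
  unfold stdNormalAbsMoment
  simp only [id, Real.enorm_eq_ofReal_abs]

theorem stdNormalAbsMoment_ne_zero {r : ℝ} (hr : 0 < r) : stdNormalAbsMoment r ≠ 0 := by
  intro h
  unfold stdNormalAbsMoment at h
  rw [lintegral_eq_zero_iff (by fun_prop)] at h
  have h2 : ∀ᵐ x ∂(gaussianReal 0 1), x = 0 := by
    filter_upwards [h] with x hx
    simp only [Pi.zero_apply] at hx
    rw [ENNReal.rpow_eq_zero_iff_of_pos hr, ENNReal.ofReal_eq_zero] at hx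
    exact abs_nonpos_iff.1 hx
  have := nullSingletonClass_gaussianReal (μ := 0) (v := 1) one_ne_zero
  have h3 : ∀ᵐ x ∂(gaussianReal 0 1), x ≠ 0 := by
    rw [ae_iff]; simp
  have h4 : ∀ᵐ x ∂(gaussianReal 0 1), False := by
    filter_upwards [h2, h3] with x hx hx'
    exact hx' hx
  rw [ae_iff] at h4
  simp at h4

section Law

variable {Ω : Type*} [MeasurableSpace Ω] {P : Measure Ω}

theorem ProbabilityTheory.HasGaussianLaw.lintegral_abs_rpow {Z : Ω → ℝ} (hZ : HasGaussianLaw Z P)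
    (hmean : ∫ ω, Z ω ∂P = 0) {r : ℝ} (hr : 0 < r) :
    ∫⁻ ω, ENNReal.ofReal |Z ω| ^ r ∂P
      = ENNReal.ofReal (Var[Z; P] ^ (r / 2)) * stdNormalAbsMoment r := by
  have hv := variance_nonneg Z P
  set v := Var[Z; P] with hvdef
  have hmap : P.map Z = (gaussianReal 0 1).map (√v * ·) := by
    rw [hZ.map_eq_gaussianReal, hmean, gaussianReal_map_const_mul, mul_zero, mul_one]
    congr 1
    ext
    rw [NNReal.coe_mk, Real.sq_sqrt hv, Real.coe_toNNReal _ hv]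
  rw [← lintegral_map' (f := fun x => ENNReal.ofReal |x| ^ r) (by fun_prop) hZ.aemeasurable, hmap,
    lintegral_map (by fun_prop) (by fun_prop), stdNormalAbsMoment,
    ← lintegral_const_mul _ (by fun_prop)]
  refine lintegral_congr fun x => ?_
  rw [abs_mul, abs_of_nonneg (Real.sqrt_nonneg v), ENNReal.ofReal_mul (Real.sqrt_nonneg v),
    ENNReal.mul_rpow_of_nonneg _ _ hr.le, ENNReal.ofReal_rpow_of_nonneg (Real.sqrt_nonneg v) hr.le,
    Real.sqrt_eq_rpow, ← Real.rpow_mul hv, one_div_mul_eq_div]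

variable {X : ℝ → Ω → ℝ}

namespace IsBrownianBridge

theorem hasGaussianLaw_eval (hX : IsBrownianBridge P X) {t : ℝ} (ht : t ∈ Set.Icc (0 : ℝ) 1) :
    HasGaussianLaw (X t) P :=
  hX.gaussian.hasGaussianLaw_eval ⟨t, ht⟩

theorem hasGaussianLaw_sub (hX : IsBrownianBridge P X) {s t : ℝ} (hs : s ∈ Set.Icc (0 : ℝ) 1)
    (ht : t ∈ Set.Icc (0 : ℝ) 1) : HasGaussianLaw (fun ω => X s ω - X t ω) P :=
  hX.gaussian.hasGaussianLaw_fun_sub (s := ⟨s, hs⟩) (t := ⟨t, ht⟩)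

theorem integral_sub_eq_zero (hX : IsBrownianBridge P X) {s t : ℝ} (hs : s ∈ Set.Icc (0 : ℝ) 1)
    (ht : t ∈ Set.Icc (0 : ℝ) 1) : ∫ ω, (X s ω - X t ω) ∂P = 0 := by
  rw [integral_sub (hX.hasGaussianLaw_eval hs).integrable (hX.hasGaussianLaw_eval ht).integrable,
    hX.mean s hs, hX.mean t ht, sub_zero]

theorem variance_sub (hX : IsBrownianBridge P X) {s t : ℝ} (hs : s ∈ Set.Icc (0 : ℝ) 1)
    (ht : t ∈ Set.Icc (0 : ℝ) 1) :
    Var[fun ω => X s ω - X t ω; P] = |s - t| - (s - t) ^ 2 := by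
  have := (hX.hasGaussianLaw_eval hs).isProbabilityMeasure
  have ms := (hX.hasGaussianLaw_eval hs).memLp_two
  have mt := (hX.hasGaussianLaw_eval ht).memLp_two
  rw [variance_fun_sub ms mt, ← covariance_self ms.aemeasurable, ← covariance_self mt.aemeasurable,
    hX.cov s hs s hs, hX.cov s hs t ht, hX.cov t ht t ht]
  rcases le_total s t with h | h
  · rw [min_eq_left h, abs_of_nonpos (by linarith)]; simp; ring
  · rw [min_eq_right h, abs_of_nonneg (by linarith)]; simp; ring

theorem lintegral_abs_sub_rpow_le (hX : IsBrownianBridge P X) {s t : ℝ}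
    (hs : s ∈ Set.Icc (0 : ℝ) 1) (ht : t ∈ Set.Icc (0 : ℝ) 1) {r : ℝ} (hr : 0 < r) :
    ∫⁻ ω, ENNReal.ofReal |X s ω - X t ω| ^ r ∂P
      ≤ ENNReal.ofReal (|s - t| ^ (r / 2)) * stdNormalAbsMoment r := by
  rw [(hX.hasGaussianLaw_sub hs ht).lintegral_abs_rpow (hX.integral_sub_eq_zero hs ht) hr]
  gcongr
  · exact variance_nonneg _ _
  · rw [hX.variance_sub hs ht]
    linarith [sq_nonneg (s - t)]

theorem ae_eq_zero (hX : IsBrownianBridge P X) : ∀ᵐ ω ∂P, X 0 ω = 0 := by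
  have h0 : (0 : ℝ) ∈ Set.Icc (0 : ℝ) 1 := by simp
  have h := hX.hasGaussianLaw_eval h0
  have := h.isProbabilityMeasure
  have hv : Var[X 0; P] = 0 := by
    rw [← covariance_self h.aemeasurable, hX.cov 0 h0 0 h0]; simp
  have := ae_eq_integral_of_variance_eq_zero h.memLp_two hv
  rwa [hX.mean 0 h0] at this

end IsBrownianBridge

/-- The Hölder exponent in the definition of `holderSup`. -/
noncomputable def holderExp (p : ℝ) : ℝ := 1 / 2 - 1 / (2 * p) - 1 / (2 * p ^ 2)

/-- The value `1/8` is attained at `p = 2`; it gives one exponent valid for all `p`. -/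
theorem one_div_eight_le_holderExp {p : ℝ} (hp : 2 ≤ p) : 1 / 8 ≤ holderExp p := by
  have h : 1 / p ≤ 1 / 2 := one_div_le_one_div_of_le (by norm_num) hp
  have h0 : 0 < 1 / p := by positivity
  have e : holderExp p = 1 / 2 - (1 / p) / 2 - (1 / p) ^ 2 / 2 := by
    unfold holderExp; field_simp
  rw [e]
  nlinarith

theorem holderExp_mul {p : ℝ} (hp : 0 < p) : 1 + holderExp p * (2 * p) - p = -(1 / p) := by
  unfold holderExp; field_simp; ring

theorem le_holderSup (p : ℝ) (γ : ℝ → ℝ) {t u : ℝ} (ht : 0 ≤ t) (htu : t < u) (hu : u ≤ 1) :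
    ENNReal.ofReal (|γ t - γ u| / |t - u| ^ holderExp p) ≤ holderSup p γ :=
  le_iSup_of_le t (le_iSup_of_le u (le_iSup_of_le ⟨ht, htu, hu⟩ le_rfl))

theorem holderSup_rpow_le_tsum {p : ℝ} (hp : 2 ≤ p) {γ : ℝ → ℝ}
    (hγ : ContinuousOn γ (Set.Icc 0 1)) :
    holderSup p γ ^ (2 * p)
      ≤ ENNReal.ofReal (dyadicConst (holderExp p) ^ (2 * p)) *
        ∑' n : ℕ, ∑ k ∈ Finset.range (2 ^ n),
        ENNReal.ofReal (((2 : ℝ) ^ (holderExp p * (2 * p))) ^ n)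
          * ENNReal.ofReal |γ ((k + 1 : ℕ) / 2 ^ n) - γ (k / 2 ^ n)| ^ (2 * p) := by
  have hr : 0 < 2 * p := by linarith
  have hα : 0 < holderExp p := by linarith [one_div_eight_le_holderExp hp]
  rw [← ENNReal.le_rpow_inv_iff hr]
  refine iSup_le fun t => iSup_le fun u => iSup_le fun h => ?_
  rw [ENNReal.le_rpow_inv_iff hr]
  exact rpow_le_of_tsum_dyadic hr hα hγ h.1 h.2.1 h.2.2

/-- A bound for the moment of order `2 p` of `holderSup p` along a Brownian bridge. -/
noncomputable def holderSupMomentBound (p : ℝ) : ℝ≥0∞ :=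
  ENNReal.ofReal (dyadicConst (holderExp p) ^ (2 * p)) *
    ∑' n : ℕ, ENNReal.ofReal (2 ^ (-(1 / p))) ^ n * stdNormalAbsMoment (2 * p)

theorem holderSupMomentBound_ne_top {p : ℝ} (hp : 0 < p) : holderSupMomentBound p ≠ ⊤ := by
  unfold holderSupMomentBound
  rw [ENNReal.tsum_mul_right, ENNReal.tsum_geometric]
  refine ENNReal.mul_ne_top ENNReal.ofReal_ne_top (ENNReal.mul_ne_top ?_
    (stdNormalAbsMoment_ne_top (by linarith)))
  rw [ENNReal.inv_ne_top]
  refine (tsub_pos_of_lt ?_).ne'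
  rw [ENNReal.ofReal_lt_one]
  exact Real.rpow_lt_one_of_one_lt_of_neg (by norm_num) (by simpa using hp)

namespace IsBrownianBridge

theorem aemeasurable_eval (hX : IsBrownianBridge P X) {t : ℝ} (ht : t ∈ Set.Icc (0 : ℝ) 1) :
    AEMeasurable (X t) P :=
  (hX.hasGaussianLaw_eval ht).aemeasurable

/-- Level `n` has `2 ^ n` increments with moments of order `2 ^ (-n p)`, so with the Hölder weights
the levels form a geometric series of ratio `2 ^ (-1/p)`, by `holderExp_mul`. -/
theorem lintegral_holderSup_rpow_le (hX : IsBrownianBridge P X) {p : ℝ} (hp : 2 ≤ p) :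
    ∫⁻ ω, holderSup p (fun t => X t ω) ^ (2 * p) ∂P ≤ holderSupMomentBound p := by
  have hr : 0 < 2 * p := by linarith
  have hmem : ∀ n k : ℕ, k ≤ 2 ^ n → (k / 2 ^ n : ℝ) ∈ Set.Icc (0 : ℝ) 1 := by
    intro n k hk
    refine ⟨by positivity, ?_⟩
    rw [div_le_one (by positivity)]
    exact_mod_cast hk
  have hmeas : ∀ n : ℕ, ∀ k ∈ Finset.range (2 ^ n), AEMeasurable (fun ω =>
      ENNReal.ofReal (((2 : ℝ) ^ (holderExp p * (2 * p))) ^ n)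
          * ENNReal.ofReal |X ((k + 1 : ℕ) / 2 ^ n) ω - X (k / 2 ^ n) ω| ^ (2 * p)) P := by
    intro n k hk
    rw [Finset.mem_range] at hk
    have h1 := hX.aemeasurable_eval (hmem n (k + 1) hk)
    have h2 := hX.aemeasurable_eval (hmem n k hk.le)
    have h3 : AEMeasurable (fun ω => |X ((k + 1 : ℕ) / 2 ^ n) ω - X (k / 2 ^ n) ω|) P :=
      (h1.sub h2).abs
    exact (h3.ennreal_ofReal.pow_const _).const_mul _
  refine (lintegral_mono fun ω => holderSup_rpow_le_tsum hp (hX.continuous_paths ω)).trans ?_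
  rw [lintegral_const_mul' _ _ ENNReal.ofReal_ne_top, lintegral_tsum fun n =>
    Finset.aemeasurable_fun_sum _ (hmeas n)]
  unfold holderSupMomentBound
  gcongr with n
  rw [lintegral_finsetSum' _ (hmeas n)]
  have hterm : ∀ k ∈ Finset.range (2 ^ n), ∫⁻ ω,
      ENNReal.ofReal (((2 : ℝ) ^ (holderExp p * (2 * p))) ^ n)
          * ENNReal.ofReal |X ((k + 1 : ℕ) / 2 ^ n) ω - X (k / 2 ^ n) ω| ^ (2 * p) ∂P
      ≤ ENNReal.ofReal (((2 : ℝ) ^ (holderExp p * (2 * p))) ^ n)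
        * (ENNReal.ofReal (((2 : ℝ) ^ (-p)) ^ n) * stdNormalAbsMoment (2 * p)) := by
    intro k hk
    rw [Finset.mem_range] at hk
    rw [lintegral_const_mul' _ _ ENNReal.ofReal_ne_top]
    gcongr
    refine (hX.lintegral_abs_sub_rpow_le (hmem n (k + 1) hk) (hmem n k hk.le) hr).trans
      (le_of_eq ?_)
    congr 2
    have e : ((k + 1 : ℕ) / 2 ^ n - k / 2 ^ n : ℝ) = ((2 : ℝ) ^ n)⁻¹ := by
      push_cast; field_simp; ring
    rw [e, abs_of_pos (by positivity), mul_div_cancel_left₀ p two_ne_zero, ← Real.rpow_natCast,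
      ← Real.rpow_natCast, ← Real.rpow_neg (by norm_num), ← Real.rpow_mul (by norm_num),
      ← Real.rpow_mul (by norm_num)]
    congr 1
    ring
  refine (Finset.sum_le_sum hterm).trans (le_of_eq ?_)
  rw [Finset.sum_const, Finset.card_range, nsmul_eq_mul, ← mul_assoc, ← mul_assoc]
  congr 1
  have e : ((2 ^ n : ℕ) : ℝ≥0∞) = ENNReal.ofReal (2 ^ n) := by
    rw [ENNReal.ofReal_pow (by norm_num)]; simp
  rw [e, ← ENNReal.ofReal_pow (by positivity), ← ENNReal.ofReal_mul (by positivity),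
    ← ENNReal.ofReal_mul (by positivity), ← mul_pow, ← mul_pow]
  congr 2
  rw [← holderExp_mul (show 0 < p by linarith), sub_eq_add_neg, Real.rpow_add (by norm_num),
    Real.rpow_add (by norm_num), Real.rpow_one]

/-- The single pair `(0, 1/2)` suffices: that increment is Gaussian with variance `1/4`, and the
denominator is at most `1`. -/
theorem le_lintegral_holderSup_rpow (hX : IsBrownianBridge P X) {p : ℝ} (hp : 2 ≤ p) :
    ENNReal.ofReal ((1 / 4) ^ p) * stdNormalAbsMoment (2 * p)
      ≤ ∫⁻ ω, holderSup p (fun t => X t ω) ^ (2 * p) ∂P := by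
  have hr : 0 < 2 * p := by linarith
  have h0 : (0 : ℝ) ∈ Set.Icc (0 : ℝ) 1 := by simp
  have h1 : (1 / 2 : ℝ) ∈ Set.Icc (0 : ℝ) 1 := by constructor <;> norm_num
  have hα : 0 < holderExp p := by linarith [one_div_eight_le_holderExp hp]
  have h := (hX.hasGaussianLaw_sub h0 h1).lintegral_abs_rpow (hX.integral_sub_eq_zero h0 h1) hr
  rw [hX.variance_sub h0 h1, mul_div_cancel_left₀ p two_ne_zero] at h
  have e : |(0 : ℝ) - 1 / 2| = 1 / 2 := by rw [abs_of_neg] <;> norm_num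
  rw [e, show (1 / 2 - (0 - 1 / 2) ^ 2 : ℝ) = 1 / 4 by norm_num] at h
  rw [← h]
  refine lintegral_mono fun ω => ?_
  gcongr
  refine le_trans (ENNReal.ofReal_le_ofReal ?_)
    (le_holderSup p (fun t => X t ω) le_rfl (show (0 : ℝ) < 1 / 2 by norm_num) (by norm_num))
  rw [e]
  refine le_div_self (abs_nonneg _) (by positivity) ?_
  exact Real.rpow_le_one (by norm_num) (by norm_num) hα.le

/-- The quotient is continuous in `(t, u)` off the diagonal, so the supremum may be taken over a
countable dense set of pairs. -/
theorem aemeasurable_holderSup (hX : IsBrownianBridge P X) (p : ℝ) :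
    AEMeasurable (fun ω => holderSup p (fun t => X t ω)) P := by
  set T := {q : ℝ × ℝ // 0 ≤ q.1 ∧ q.1 < q.2 ∧ q.2 ≤ 1}
  have : Nonempty T := ⟨⟨(0, 1), by norm_num⟩⟩
  set f : T → Ω → ℝ≥0∞ := fun q ω =>
    ENNReal.ofReal (|X q.1.1 ω - X q.1.2 ω| / |q.1.1 - q.1.2| ^ holderExp p) with hf
  have hm1 : ∀ q : T, q.1.1 ∈ Set.Icc (0 : ℝ) 1 := fun q => ⟨q.2.1, q.2.2.1.le.trans q.2.2.2⟩
  have hm2 : ∀ q : T, q.1.2 ∈ Set.Icc (0 : ℝ) 1 := fun q => ⟨q.2.1.trans q.2.2.1.le, q.2.2.2⟩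
  have hfc : ∀ ω, Continuous fun q => f q ω := by
    intro ω
    have c1 : Continuous fun q : T => X q.1.1 ω :=
      (hX.continuous_paths ω).comp_continuous (f := fun q : T => q.1.1) (by fun_prop) hm1
    have c2 : Continuous fun q : T => X q.1.2 ω :=
      (hX.continuous_paths ω).comp_continuous (f := fun q : T => q.1.2) (by fun_prop) hm2
    have hne : ∀ q : T, |q.1.1 - q.1.2| ≠ 0 := fun q => abs_ne_zero.2 (sub_ne_zero.2 q.2.2.1.ne)
    have c3 : Continuous fun q : T => |q.1.1 - q.1.2| ^ holderExp p :=
      Continuous.rpow_const (by fun_prop) fun q => Or.inl (hne q)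
    exact ENNReal.continuous_ofReal.comp ((c1.sub c2).abs.div c3 fun q =>
      (Real.rpow_pos_of_pos (lt_of_le_of_ne (abs_nonneg _) (hne q).symm) _).ne')
  have e : (fun ω => holderSup p (fun t => X t ω))
      = fun ω => ⨆ n, f (TopologicalSpace.denseSeq T n) ω := by
    funext ω
    refine le_antisymm ?_ ?_
    · have key : ∀ q : T, f q ω ≤ ⨆ n, f (TopologicalSpace.denseSeq T n) ω :=
        isClosed_property (TopologicalSpace.denseRange_denseSeq T)
          (isClosed_le (hfc ω) continuous_const)
          fun n => le_iSup (fun n => f (TopologicalSpace.denseSeq T n) ω) n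
      exact iSup_le fun t => iSup_le fun u => iSup_le fun h => key ⟨(t, u), h⟩
    · exact iSup_le fun n =>
        have hn := (TopologicalSpace.denseSeq T n).2
        le_holderSup p (fun t => X t ω) hn.1 hn.2.1 hn.2.2
  rw [e]
  refine AEMeasurable.iSup fun n => ?_
  have h1 := hX.aemeasurable_eval (hm1 (TopologicalSpace.denseSeq T n))
  have h2 := hX.aemeasurable_eval (hm2 (TopologicalSpace.denseSeq T n))
  have h3 := (h1.sub h2).abs
  exact (h3.div_const _).ennreal_ofReal

theorem memLp_holderSup (hX : IsBrownianBridge P X) {p : ℝ} (hp : 2 ≤ p) :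
    MemLp (fun ω => holderSup p (fun t => X t ω)) (ENNReal.ofReal (2 * p)) P := by
  have hr : 0 < 2 * p := by linarith
  refine ⟨(hX.aemeasurable_holderSup p).aestronglyMeasurable, ?_⟩
  rw [eLpNorm_lt_top_iff_lintegral_rpow_enorm_lt_top (ENNReal.ofReal_pos.2 hr).ne'
    ENNReal.ofReal_ne_top, ENNReal.toReal_ofReal hr.le]
  simp only [enorm_eq_self]
  exact (hX.lintegral_holderSup_rpow_le hp).trans_lt
    (holderSupMomentBound_ne_top (by linarith)).lt_top

end IsBrownianBridge

end Law

/-! ### Small ball probabilities of the bridge. -/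

section Law

variable {Ω : Type*} [MeasurableSpace Ω] {P : Measure Ω} {X : ℝ → Ω → ℝ}

theorem gaussianReal_abs_le_le {v : NNReal} (hv : v ≠ 0) (δ : ℝ) :
    gaussianReal 0 v {x | |x| ≤ δ} ≤ ENNReal.ofReal (2 * δ / √v) := by
  have hv0 : (0 : ℝ) < v := NNReal.coe_pos.2 (pos_iff_ne_zero.2 hv)
  rw [gaussianReal_apply _ hv]
  have hset : {x : ℝ | |x| ≤ δ} = Set.Icc (-δ) δ := by ext x; simp [abs_le]
  have hpdf : ∀ x, gaussianPDF 0 v x ≤ ENNReal.ofReal (1 / √v) := by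
    intro x
    refine ENNReal.ofReal_le_ofReal ?_
    unfold gaussianPDFReal
    have h1 : Real.exp (-(x - 0) ^ 2 / (2 * v)) ≤ 1 := by
      rw [Real.exp_le_one_iff]
      exact div_nonpos_of_nonpos_of_nonneg (neg_nonpos.2 (sq_nonneg _)) (by positivity)
    have h2 : (√(2 * Real.pi * v))⁻¹ ≤ 1 / √v := by
      rw [one_div]
      gcongr
      nlinarith [Real.pi_gt_three]
    calc (√(2 * Real.pi * v))⁻¹ * Real.exp (-(x - 0) ^ 2 / (2 * v))
        ≤ (√(2 * Real.pi * v))⁻¹ * 1 := by gcongr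
      _ ≤ 1 / √v := by rwa [mul_one]
  refine (lintegral_mono hpdf).trans (le_of_eq ?_)
  rw [lintegral_const, Measure.restrict_apply_univ, hset, Real.volume_Icc,
    ← ENNReal.ofReal_mul (by positivity)]
  congr 1
  ring

/-- The second difference `2 γ b - γ a - γ c`. -/
def secondDiff (X : ℝ → Ω → ℝ) (a b c : ℝ) (ω : Ω) : ℝ := 2 * X b ω - X a ω - X c ω

namespace IsBrownianBridge

theorem cov_secondDiff (hX : IsBrownianBridge P X) {a b c d e f : ℝ}
    (ha : a ∈ Set.Icc (0 : ℝ) 1) (hb : b ∈ Set.Icc (0 : ℝ) 1) (hc : c ∈ Set.Icc (0 : ℝ) 1)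
    (hd : d ∈ Set.Icc (0 : ℝ) 1) (he : e ∈ Set.Icc (0 : ℝ) 1) (hf : f ∈ Set.Icc (0 : ℝ) 1) :
    cov[secondDiff X a b c, secondDiff X d e f; P]
      = 2 * (2 * (min b e - b * e) - (min b d - b * d) - (min b f - b * f))
        - (2 * (min a e - a * e) - (min a d - a * d) - (min a f - a * f))
        - (2 * (min c e - c * e) - (min c d - c * d) - (min c f - c * f)) := by
  have := (hX.hasGaussianLaw_eval ha).isProbabilityMeasure
  have m : ∀ t ∈ Set.Icc (0 : ℝ) 1, MemLp (X t) 2 P := fun t ht =>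
    (hX.hasGaussianLaw_eval ht).memLp_two
  have m2 : ∀ t ∈ Set.Icc (0 : ℝ) 1, MemLp (fun ω => 2 * X t ω) 2 P := fun t ht =>
    (m t ht).const_mul 2
  have m3 : ∀ s ∈ Set.Icc (0 : ℝ) 1, ∀ t ∈ Set.Icc (0 : ℝ) 1,
      MemLp (fun ω => 2 * X s ω - X t ω) 2 P := fun s hs t ht => (m2 s hs).sub (m t ht)
  have hr : ∀ s ∈ Set.Icc (0 : ℝ) 1, cov[X s, secondDiff X d e f; P]
      = 2 * (min s e - s * e) - (min s d - s * d) - (min s f - s * f) := by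
    intro s hs
    unfold secondDiff
    rw [covariance_fun_sub_right (m s hs) (m3 e he d hd) (m f hf),
      covariance_fun_sub_right (m s hs) (m2 e he) (m d hd), covariance_const_mul_right,
      hX.cov s hs e he, hX.cov s hs d hd, hX.cov s hs f hf]
  have mr : MemLp (secondDiff X d e f) 2 P := (m3 e he d hd).sub (m f hf)
  have hl : secondDiff X a b c = fun ω => 2 * X b ω - X a ω - X c ω := rfl
  rw [hl, covariance_fun_sub_left (m3 b hb a ha) (m c hc) mr,
    covariance_fun_sub_left (m2 b hb) (m a ha) mr, covariance_const_mul_left, hr b hb, hr a ha,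
    hr c hc]

/-- For `s ≤ t` the covariance is the product `s (1 - t)`, so the second difference in `s` factors
out; it is `2 b - a - c = 0`. Plain increments of the bridge would remain correlated. -/
theorem cov_secondDiff_of_le (hX : IsBrownianBridge P X) {a b c d e f : ℝ} (h0 : 0 ≤ a)
    (hab : a ≤ b) (hbc : b ≤ c) (hcd : c ≤ d) (hde : d ≤ e) (hef : e ≤ f) (h1 : f ≤ 1)
    (hmid : 2 * b = a + c) :
    cov[secondDiff X a b c, secondDiff X d e f; P] = 0 := by
  rw [hX.cov_secondDiff ⟨h0, by linarith⟩ ⟨by linarith, by linarith⟩ ⟨by linarith, by linarith⟩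
    ⟨by linarith, by linarith⟩ ⟨by linarith, by linarith⟩ ⟨by linarith, h1⟩]
  iterate 9 rw [min_eq_left (by linarith)]
  linear_combination (-2 * e + d + f) * hmid

theorem secondDiff_law (hX : IsBrownianBridge P X) {ι : Type*} [Finite ι] {a b c : ι → ℝ}
    (ha : ∀ i, a i ∈ Set.Icc (0 : ℝ) 1) (hb : ∀ i, b i ∈ Set.Icc (0 : ℝ) 1)
    (hc : ∀ i, c i ∈ Set.Icc (0 : ℝ) 1) :
    HasGaussianLaw (fun ω i => secondDiff X (a i) (b i) (c i) ω) P := by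
  classical
  have := Fintype.ofFinite ι
  let I : Finset (Set.Icc (0 : ℝ) 1) :=
    Finset.univ.image (fun i => ⟨a i, ha i⟩) ∪ Finset.univ.image (fun i => ⟨b i, hb i⟩)
      ∪ Finset.univ.image (fun i => ⟨c i, hc i⟩)
  let L : (I → ℝ) →L[ℝ] ι → ℝ :=
    { toFun x i := 2 * x ⟨⟨b i, hb i⟩, by simp [I]⟩ - x ⟨⟨a i, ha i⟩, by simp [I]⟩
        - x ⟨⟨c i, hc i⟩, by simp [I]⟩
      map_add' x y := by ext; simp; ring
      map_smul' m x := by ext; simp; ring }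
  exact (hX.gaussian.hasGaussianLaw I).map L

/-- The second differences over `n` consecutive intervals are jointly Gaussian and uncorrelated,
hence independent, each of variance `1/n`. On the event each is at most `4 * δ` in modulus, which
has probability at most `8 √n δ`. -/
theorem measure_abs_le_le (hX : IsBrownianBridge P X) {n : ℕ} (hn : 0 < n) {δ : ℝ} (hδ : 0 ≤ δ) :
    P {ω | ∀ t ∈ Set.Icc (0 : ℝ) 1, |X t ω| ≤ δ} ≤ ENNReal.ofReal ((8 * √n * δ) ^ n) := by
  have hn0 : (0 : ℝ) < n := by exact_mod_cast hn
  set a : Fin n → ℝ := fun j => j / n with ha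
  set b : Fin n → ℝ := fun j => (j + 1 / 2) / n with hb
  set c : Fin n → ℝ := fun j => (j + 1) / n with hc
  have ha0 : ∀ j, 0 ≤ a j := fun j => by simp only [ha]; positivity
  have hab : ∀ j, a j ≤ b j := fun j => by simp only [ha, hb]; gcongr; linarith
  have hbc : ∀ j, b j ≤ c j := fun j => by simp only [hb, hc]; gcongr; linarith
  have hc1 : ∀ j, c j ≤ 1 := fun j => by
    simp only [hc]
    rw [div_le_one hn0]
    exact_mod_cast j.2
  have hmid : ∀ j, 2 * b j = a j + c j := fun j => by simp only [ha, hb, hc]; field_simp; ring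
  have hlen : ∀ j, c j - a j = 1 / n := fun j => by simp only [ha, hc]; field_simp; ring
  have hca : ∀ i j : Fin n, i < j → c i ≤ a j := fun i j hij => by
    simp only [ha, hc]
    gcongr
    exact_mod_cast hij
  have hma : ∀ j, a j ∈ Set.Icc (0 : ℝ) 1 := fun j =>
    ⟨ha0 j, by linarith [hab j, hbc j, hc1 j]⟩
  have hmb : ∀ j, b j ∈ Set.Icc (0 : ℝ) 1 := fun j =>
    ⟨by linarith [ha0 j, hab j], by linarith [hbc j, hc1 j]⟩
  have hmc : ∀ j, c j ∈ Set.Icc (0 : ℝ) 1 := fun j =>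
    ⟨by linarith [ha0 j, hab j, hbc j], hc1 j⟩
  set Z : Fin n → Ω → ℝ := fun j => secondDiff X (a j) (b j) (c j) with hZ
  have hlaw : HasGaussianLaw (fun ω j => Z j ω) P := hX.secondDiff_law hma hmb hmc
  have hind : iIndepFun Z P := by
    refine hlaw.iIndepFun_of_covariance_eq_zero fun i j hij => ?_
    rcases lt_or_gt_of_ne hij with h | h
    · exact hX.cov_secondDiff_of_le (ha0 i) (hab i) (hbc i) (hca i j h) (hab j) (hbc j) (hc1 j)
        (hmid i)
    · rw [covariance_comm]
      exact hX.cov_secondDiff_of_le (ha0 j) (hab j) (hbc j) (hca j i h) (hab i) (hbc i) (hc1 i)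
        (hmid j)
  have hZlaw : ∀ j, HasGaussianLaw (Z j) P := fun j => hlaw.eval j
  have hZmean : ∀ j, ∫ ω, Z j ω ∂P = 0 := by
    intro j
    have i1 := (hX.hasGaussianLaw_eval (hma j)).integrable
    have i2 := (hX.hasGaussianLaw_eval (hmb j)).integrable
    have i3 := (hX.hasGaussianLaw_eval (hmc j)).integrable
    have i4 : Integrable (fun ω => 2 * X (b j) ω - X (a j) ω) P := (i2.const_mul 2).sub i1
    simp only [hZ, secondDiff]
    rw [integral_sub i4 i3, integral_sub (i2.const_mul 2) i1,
      integral_const_mul, hX.mean _ (hma j), hX.mean _ (hmb j), hX.mean _ (hmc j)]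
    ring
  have hZvar : ∀ j, Var[Z j; P] = 1 / n := by
    intro j
    rw [← covariance_self (hZlaw j).aemeasurable, hX.cov_secondDiff (hma j) (hmb j) (hmc j)
      (hma j) (hmb j) (hmc j), min_self, min_self, min_self, min_eq_left (hbc j),
      min_eq_right (hab j), min_eq_left (hab j), min_eq_right (hbc j),
      min_eq_left ((hab j).trans (hbc j)), min_eq_right ((hab j).trans (hbc j)), ← hlen j]
    linear_combination (-(2 * b j) + a j + c j) * hmid j
  have hZprob : ∀ j, P (Z j ⁻¹' {x | |x| ≤ 4 * δ}) ≤ ENNReal.ofReal (8 * √n * δ) := by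
    intro j
    have hs : MeasurableSet {x : ℝ | |x| ≤ 4 * δ} :=
      measurableSet_le (by fun_prop) measurable_const
    rw [← Measure.map_apply_of_aemeasurable (hZlaw j).aemeasurable hs,
      (hZlaw j).map_eq_gaussianReal, hZmean j, hZvar j]
    have hv : (1 / n : ℝ).toNNReal ≠ 0 := (Real.toNNReal_pos.2 (by positivity)).ne'
    refine (gaussianReal_abs_le_le hv _).trans (le_of_eq ?_)
    rw [Real.coe_toNNReal _ (by positivity), one_div, Real.sqrt_inv, div_inv_eq_mul]
    congr 1
    ring
  have hsub : {ω | ∀ t ∈ Set.Icc (0 : ℝ) 1, |X t ω| ≤ δ}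
      ⊆ ⋂ j ∈ (Finset.univ : Finset (Fin n)), Z j ⁻¹' {x | |x| ≤ 4 * δ} := by
    intro ω hω
    simp only [Set.mem_iInter]
    intro j _
    have h1 := abs_le.1 (hω _ (hma j))
    have h2 := abs_le.1 (hω _ (hmb j))
    have h3 := abs_le.1 (hω _ (hmc j))
    simp only [Set.mem_preimage, Set.mem_ofPred_eq, hZ, secondDiff]
    exact abs_le.2 ⟨by linarith, by linarith⟩
  refine (measure_mono hsub).trans ?_
  rw [hind.measure_inter_preimage_eq_mul Finset.univ
    (sets := fun _ => {x : ℝ | |x| ≤ 4 * δ})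
    (fun _ _ => measurableSet_le (by fun_prop) measurable_const)]
  refine (Finset.prod_le_prod' fun j _ => hZprob j).trans (le_of_eq ?_)
  rw [Finset.prod_const, Finset.card_univ, Fintype.card_fin, ENNReal.ofReal_pow (by positivity)]

end IsBrownianBridge

end Law

/-! ### Decay faster than every power, and the conclusion. -/

theorem abs_sub_le_of_holderSup_le {p H : ℝ} (hp : 2 ≤ p) (hH : 0 ≤ H) {γ : ℝ → ℝ}
    (h : holderSup p γ ≤ ENNReal.ofReal H) {t u : ℝ} (ht : t ∈ Set.Icc (0 : ℝ) 1)
    (hu : u ∈ Set.Icc (0 : ℝ) 1) : |γ t - γ u| ≤ H * |t - u| ^ (1 / 8 : ℝ) := by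
  wlog htu : t ≤ u generalizing t u
  · rw [abs_sub_comm, abs_sub_comm t u]
    exact this hu ht (le_of_not_ge htu)
  rcases htu.eq_or_lt with rfl | hlt
  · simp
  have h1 := (le_holderSup p γ ht.1 hlt hu.2).trans h
  rw [ENNReal.ofReal_le_ofReal_iff hH] at h1
  have h0 : 0 < |t - u| := abs_pos.2 (sub_ne_zero.2 hlt.ne)
  have h01 : |t - u| ≤ 1 := abs_le.2 ⟨by linarith [ht.1, hu.2], by linarith⟩
  rw [div_le_iff₀ (Real.rpow_pos_of_pos h0 _)] at h1
  refine h1.trans (mul_le_mul_of_nonneg_left ?_ hH)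
  exact Real.rpow_le_rpow_of_exponent_ge h0 h01 (one_div_eight_le_holderExp hp)

section Law

variable {Ω : Type*} [MeasurableSpace Ω] {P : Measure Ω} {X : ℝ → Ω → ℝ}

namespace IsBrownianBridge

theorem measure_lt_holderSup_le (hX : IsBrownianBridge P X) {p : ℝ} (hp : 2 ≤ p) {H : ℝ}
    (hH : 0 < H) :
    P {ω | ENNReal.ofReal H < holderSup p (fun t => X t ω)}
      ≤ ENNReal.ofReal ((holderSupMomentBound p).toReal * H ^ (-(2 * p))) := by
  have hr : 0 < 2 * p := by linarith
  have hsub : {ω | ENNReal.ofReal H < holderSup p (fun t => X t ω)}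
      ⊆ {ω | ENNReal.ofReal H ^ (2 * p) ≤ holderSup p (fun t => X t ω) ^ (2 * p)} :=
    fun ω hω => ENNReal.rpow_le_rpow (le_of_lt hω) hr.le
  have hpos : ENNReal.ofReal H ^ (2 * p) ≠ 0 := by
    rw [Ne, ENNReal.rpow_eq_zero_iff_of_pos hr]
    exact (ENNReal.ofReal_pos.2 hH).ne'
  refine (measure_mono hsub).trans ?_
  refine (meas_ge_le_lintegral_div ((hX.aemeasurable_holderSup p).pow_const _) hpos
    (ENNReal.rpow_ne_top_of_nonneg hr.le ENNReal.ofReal_ne_top)).trans ?_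
  rw [ENNReal.ofReal_mul ENNReal.toReal_nonneg,
    ENNReal.ofReal_toReal (holderSupMomentBound_ne_top (by linarith)), div_eq_mul_inv,
    ← ENNReal.rpow_neg, ENNReal.ofReal_rpow_of_pos hH]
  gcongr
  exact hX.lintegral_holderSup_rpow_le hp

theorem setOf_iInf_pathVar_lt_subset (hX : IsBrownianBridge P X) {p : ℝ} (hp : 2 ≤ p)
    {θ m H x : ℝ} (hH : 1 ≤ H) (hm0 : 0 < m) (hm1 : m ≤ 1 / 8)
    (hx : x ≤ m ^ 26 / (4 ^ 27 * H ^ 24)) :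
    {ω | (⨅ ε : Set.Icc (0 : ℝ) 1, pathVar θ ε (fun t => X t ω)) < x}
      ⊆ {ω | ¬ X 0 ω = 0} ∪ ({ω | ENNReal.ofReal H < holderSup p (fun t => X t ω)}
        ∪ {ω | ∀ t ∈ Set.Icc (0 : ℝ) 1, |X t ω| ≤ 8 * m}) := by
  intro ω hω
  by_cases h0 : X 0 ω = 0
  swap
  · exact Or.inl h0
  by_cases hS : ENNReal.ofReal H < holderSup p (fun t => X t ω)
  · exact Or.inr (Or.inl hS)
  refine Or.inr (Or.inr fun t ht => ?_)
  have : Nonempty (Set.Icc (0 : ℝ) 1) := ⟨⟨0, by simp⟩⟩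
  have hω' : (⨅ ε : Set.Icc (0 : ℝ) 1, pathVar θ ε (fun t => X t ω)) < x := hω
  obtain ⟨ε, hε⟩ := exists_lt_of_ciInf_lt hω'
  exact (abs_lt_of_pathVar_lt (hX.continuous_paths ω) h0 hH hm0 hm1
    (fun t ht u hu => abs_sub_le_of_holderSup_le hp (by linarith) (not_lt.1 hS) ht hu) ε.2
    (hε.trans_le hx) t ht).le

end IsBrownianBridge

end Law

/-- The probability that `V_ε^θ` is smaller than `x` for some `ε` decays faster than every power
of `x`, uniformly in `θ`. -/
theorem exists_measure_iInf_pathVar_lt_le (q : ℝ) :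
    ∃ A : ℝ, 0 < A ∧
      ∀ (Ω : Type*) [MeasurableSpace Ω] (P : Measure Ω) (X : ℝ → Ω → ℝ),
        IsBrownianBridge P X → ∀ θ : ℝ, ∀ x ∈ Set.Ioc (0 : ℝ) 1,
          P {ω | (⨅ ε : Set.Icc (0 : ℝ) 1, pathVar θ ε (fun t => X t ω)) < x}
            ≤ ENNReal.ofReal (A * x ^ q) := by
  -- With `H = x ^ (-1/48)`, Markov's inequality of order `2 * r` gives `x ^ (r/24)`; with radius
  -- `128 * x ^ (1/52)`, `N` second differences give a multiple of `x ^ (N/52)`. Both exponents are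
  -- made at least `q`.
  set r := max 2 (24 * q) with hr
  have hr2 : 2 ≤ r := le_max_left _ _
  have hrq : 24 * q ≤ r := le_max_right _ _
  set N := ⌈52 * q⌉₊ + 1 with hN
  have hN0 : 0 < N := Nat.succ_pos _
  have hN1 : (1 : ℝ) ≤ N := by exact_mod_cast hN0
  have hNq : 52 * q ≤ N := by
    have := Nat.le_ceil (52 * q)
    rw [hN]; push_cast; linarith
  have hsqrt : 1 ≤ √(N : ℝ) := Real.one_le_sqrt.2 hN1
  set M := (holderSupMomentBound r).toReal with hM
  have hM0 : 0 ≤ M := ENNReal.toReal_nonneg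
  set K : ℝ := (8 * √N * 128) ^ N with hK
  have hK0 : 0 < K := by positivity
  refine ⟨M + K, by positivity, ?_⟩
  intro Ω _ P X hX θ x hx
  have hP : IsProbabilityMeasure P :=
    (hX.hasGaussianLaw_eval (t := 0) (by simp)).isProbabilityMeasure
  have hx0 := hx.1
  set y := x ^ (1 / 52 : ℝ) with hy
  have hy0 : 0 < y := by positivity
  have hyN : y ^ N ≤ x ^ q := by
    rw [hy, ← Real.rpow_natCast, ← Real.rpow_mul hx0.le]
    refine Real.rpow_le_rpow_of_exponent_ge hx0 hx.2 ?_
    linarith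
  have hKy : (8 * √N * (128 * y)) ^ N ≤ K * x ^ q := by
    rw [← mul_assoc, mul_pow, ← hK]
    gcongr
  have hxq : 0 < x ^ q := by positivity
  rcases le_or_gt (128 * y) 1 with hsmall | hlarge
  · set H := x ^ (-(1 / 48) : ℝ) with hH
    have hH1 : 1 ≤ H := Real.one_le_rpow_of_pos_of_le_one_of_nonpos hx0 hx.2 (by norm_num)
    -- The powers `1/52` and `-1/48` split `x` evenly: `y ^ 26` and `(H ^ 24)⁻¹` are both `√x`, and
    -- `16 ^ 26 ≥ 4 ^ 27`.
    have hxm : x ≤ (16 * y) ^ 26 / (4 ^ 27 * H ^ 24) := by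
      have e1 : y ^ 26 = x ^ (1 / 2 : ℝ) := by
        rw [hy, ← Real.rpow_natCast, ← Real.rpow_mul hx0.le]; norm_num
      have e2 : H ^ 24 = (x ^ (1 / 2 : ℝ))⁻¹ := by
        rw [hH, ← Real.rpow_natCast, ← Real.rpow_mul hx0.le, ← Real.rpow_neg hx0.le]; norm_num
      have e3 : x ^ (1 / 2 : ℝ) * x ^ (1 / 2 : ℝ) = x := by
        rw [← Real.rpow_add hx0]; norm_num
      rw [mul_pow, e1, e2, ← div_eq_mul_inv, div_div_eq_mul_div, mul_assoc, e3]
      rw [le_div_iff₀ (by norm_num), mul_comm]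
      gcongr
      norm_num
    refine (measure_mono (hX.setOf_iInf_pathVar_lt_subset hr2 hH1 (by positivity)
      (by linarith) hxm)).trans ?_
    have hz : P {ω | ¬ X 0 ω = 0} = 0 := ae_iff.1 hX.ae_eq_zero
    have h1 := hX.measure_lt_holderSup_le hr2 (H := H) (by positivity)
    have h2 := hX.measure_abs_le_le hN0 (δ := 8 * (16 * y)) (by positivity)
    have h3 : M * H ^ (-(2 * r)) ≤ M * x ^ q := by
      refine mul_le_mul_of_nonneg_left ?_ hM0
      rw [hH, ← Real.rpow_mul hx0.le]
      exact Real.rpow_le_rpow_of_exponent_ge hx0 hx.2 (by linarith)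
    have h4 : (8 * √N * (8 * (16 * y))) ^ N ≤ K * x ^ q := by
      rw [show 8 * (16 * y) = 128 * y by ring]
      exact hKy
    refine (measure_union_le _ _).trans ?_
    rw [hz, zero_add, add_mul, ENNReal.ofReal_add (by positivity) (by positivity)]
    exact (measure_union_le _ _).trans (add_le_add (h1.trans (ENNReal.ofReal_le_ofReal h3))
      (h2.trans (ENNReal.ofReal_le_ofReal h4)))
  -- When `x` is not small the bound exceeds `1`.
  · refine prob_le_one.trans ?_
    rw [ENNReal.one_le_ofReal]
    have h1 : 1 ≤ (8 * √N * (128 * y)) ^ N := one_le_pow₀ (by nlinarith)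
    have h2 : 0 ≤ M * x ^ q := by positivity
    linarith

theorem proposition5p3 (p : ℝ) (hp : 2 ≤ p) :
    ∃ C : ℝ, 0 < C ∧
      ∀ (Ω : Type*) [MeasurableSpace Ω] (P : Measure Ω) (X : ℝ → Ω → ℝ),
        IsProbabilityMeasure P → IsBrownianBridge P X →
          MemLp (fun ω => holderSup p (fun t => X t ω)) (ENNReal.ofReal (2 * p)) P ∧
          ∀ x ∈ Set.Icc (0 : ℝ) 1,
            (⨆ θ : ℝ, P {ω | (⨅ ε : Set.Icc (0 : ℝ) 1, pathVar θ ε (fun t => X t ω)) < x}) ≤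
              ENNReal.ofReal C * (∫⁻ ω, holderSup p (fun t => X t ω) ^ (2 * p) ∂P)
                  * ENNReal.ofReal (x ^ ((2 * p - 3 - 3 / p) / 4))
                + ENNReal.ofReal (min 2
                    (4 * √Real.pi * x ^ (-(1 / 8) : ℝ)
                        * Real.exp (-(Real.pi / 196) * x ^ (-(1 / 4) : ℝ))
                      / (7 * (1 - Real.exp (-(2 * Real.pi / 49) * x ^ (-(1 / 4) : ℝ)))))) := by
  obtain ⟨A, hA, hbound⟩ := exists_measure_iInf_pathVar_lt_le ((2 * p - 3 - 3 / p) / 4)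
  have hr : 0 < 2 * p := by linarith
  have htop := stdNormalAbsMoment_ne_top hr
  -- The lower bound for the moment, independent of the probability space; dividing by it keeps the
  -- constant dependent on `p` only.
  set c : ℝ := (1 / 4) ^ p * (stdNormalAbsMoment (2 * p)).toReal with hc
  have hc0 : 0 < c :=
    mul_pos (by positivity) (ENNReal.toReal_pos (stdNormalAbsMoment_ne_zero hr) htop)
  refine ⟨A / c, by positivity, ?_⟩
  intro Ω _ P X _ hX
  refine ⟨hX.memLp_holderSup hp, fun x hx => iSup_le fun θ => ?_⟩
  rcases hx.1.eq_or_lt with rfl | hx0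
  · have hempty : {ω | (⨅ ε : Set.Icc (0 : ℝ) 1, pathVar θ ε (fun t => X t ω)) < 0} = ∅ :=
      Set.eq_empty_of_forall_notMem fun ω hω =>
        not_lt.2 (Real.iInf_nonneg fun ε => variance_nonneg _ _) hω
    rw [hempty, measure_empty]
    exact zero_le
  refine (hbound Ω P X hX θ x ⟨hx0, hx.2⟩).trans (le_add_right ?_)
  rw [ENNReal.ofReal_mul hA.le]
  gcongr
  calc ENNReal.ofReal A = ENNReal.ofReal (A / c) * ENNReal.ofReal c := by
        rw [← ENNReal.ofReal_mul (by positivity), div_mul_cancel₀ _ hc0.ne']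
    _ ≤ _ := by
        gcongr
        rw [hc, ENNReal.ofReal_mul (by positivity), ENNReal.ofReal_toReal htop]
        exact hX.le_lintegral_holderSup_rpow hp
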